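/- Let $G$ be a discrete group, let $1<p<\infty$ and $\frac1p+\frac1q=1$. Let $A_p(G)$ be the Herz algebra of $G$, that is, the space of all functions $u:G\to\mathbb C$ of the form $$u=\sum_{i=1}^\infty g_i*f_i^{\vee},\qquad f_i\in\ell^p(G),\ g_i\in\ell^q(G),\ \sum_{i=1}^\infty\|f_i\|_p\|g_i\|_q<\infty,$$ where $f^\vee(x)=f(x^{-1})$ and $(g*h)(x)=\sum_{y\in G}g(y)h(y^{-1}x)$, with the norm $\|u\|_{A_p(G)}=\inf\sum_i\|f_i\|_p\|g_i\|_q$, the infimum being over all such representations of $u$. Let $B_p(G)$ be the set of bounded functions $u:G\to\mathbb C$ such that $uv\in A_p(G)$ for all $v\in A_p(G)$; for $u\in B_p(G)$ let $\Gamma_u:A_p(G)\to A_p(G)$, $\Gamma_u(v)=uv$; and let $WCB_p(G)$ be the set of $u\in B_p(G)$ for which $\Gamma_u$ is a weakly compact operator. Then: (i) $A_p(G)\subseteq WCB_p(G)$; moreover, for every $u\in A_p(G)$ the operator $\Gamma_u$ is compact. (ii) If $G$ is amenable (that is, $\ell^\infty(G)$ has a left-invariant mean), then $WCB_p(G)=A_p(G)$.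 -/

import Mathlib

open scoped ENNReal

/-! Throughout, `G` is a group with the discrete topology and counting measure as Haar measure, and
`p` is a real number with `1 < p`. -/

namespace DiscreteHerz

noncomputable section

/-- Convolution on a discrete group: `(g * h)(x) = ∑ y, g(y) h(y⁻¹ x)`. -/
def conv {G : Type*} [Group G] (g h : G → ℂ) (x : G) : ℂ := ∑' y : G, g y * h (y⁻¹ * x)

/-- The function `f^∨`, `f^∨(x) = f(x⁻¹)`. -/
def check {G : Type*} [Group G] (f : G → ℂ) (x : G) : ℂ := f x⁻¹

/-- `ℓ^r(G)` for a real exponent `r`, complex-valued, with its usual norm. -/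
abbrev Ell (G : Type*) (r : ℝ) : Type _ := lp (fun _ : G => ℂ) (ENNReal.ofReal r)

/-- `u = ∑ i, g_i * f_i^∨` pointwise, with `f_i ∈ ℓ^p(G)`, `g_i ∈ ℓ^q(G)`, `q` the exponent conjugate
to `p`, and `∑ i, ‖f_i‖_p ‖g_i‖_q < ∞`. -/
def IsHerzRep {G : Type*} [Group G] (p : ℝ) (u : G → ℂ) (f : ℕ → Ell G p)
    (g : ℕ → Ell G p.conjExponent) : Prop :=
  Summable (fun i => ‖f i‖ * ‖g i‖) ∧
    ∀ x : G, HasSum (fun i => conv (g i) (check (f i)) x) (u x)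

section lemmas

variable {G : Type*} [Group G] {p : ℝ}

theorem conv_check (g f : G → ℂ) (x : G) :
    conv g (check f) x = ∑' y : G, g y * f (x⁻¹ * y) := by
  simp [conv, check]

theorem conv_bound (hp : 1 < p) (f : Ell G p) (g : Ell G p.conjExponent) (x : G) :
    ‖conv g (check f) x‖ ≤ ‖f‖ * ‖g‖ := by
  have hpq : p.HolderConjugate p.conjExponent := .conjExponent hp
  have hP : (ENNReal.ofReal p).toReal = p := ENNReal.toReal_ofReal hpq.nonneg
  have hQ : (ENNReal.ofReal p.conjExponent).toReal = p.conjExponent :=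
    ENNReal.toReal_ofReal hpq.symm.nonneg
  have hf := lp.hasSum_norm (by rw [hP]; exact hpq.pos) f
  have hg := lp.hasSum_norm (by rw [hQ]; exact hpq.symm.pos) g
  rw [hP] at hf
  rw [hQ] at hg
  have hf' : HasSum (fun y => ‖f (x⁻¹ * y)‖ ^ p) (‖f‖ ^ p) :=
    (Equiv.mulLeft x⁻¹).hasSum_iff.2 hf
  obtain ⟨C, -, hC, hsum⟩ := Real.inner_le_Lp_mul_Lq_hasSum_of_nonneg hpq
    (lp.norm_nonneg' f) (lp.norm_nonneg' g) (fun y => norm_nonneg (f (x⁻¹ * y)))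
    (fun y => norm_nonneg (g y)) hf' hg
  rw [conv_check]
  refine le_trans (tsum_of_norm_bounded hsum fun y => ?_) hC
  rw [norm_mul, mul_comm]

theorem IsHerzRep.bound (hp : 1 < p) {u : G → ℂ} {f : ℕ → Ell G p}
    {g : ℕ → Ell G p.conjExponent} (h : IsHerzRep p u f g) (x : G) :
    ‖u x‖ ≤ ∑' i, ‖f i‖ * ‖g i‖ := by
  rw [← (h.2 x).tsum_eq]
  exact tsum_of_norm_bounded h.1.hasSum fun i => conv_bound hp (f i) (g i) x

theorem isHerzRep_zero : IsHerzRep (G := G) p 0 0 0 := by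
  refine ⟨by simp, fun x => ?_⟩
  have e : (fun i : ℕ => conv ((0 : ℕ → Ell G p.conjExponent) i)
      (check ((0 : ℕ → Ell G p) i)) x) = fun _ => 0 := by
    funext i
    simp [conv, check]
  rw [e]
  exact hasSum_zero

theorem IsHerzRep.smul (hp : 1 < p) {u : G → ℂ} {f : ℕ → Ell G p}
    {g : ℕ → Ell G p.conjExponent} (h : IsHerzRep p u f g) (c : ℂ) :
    IsHerzRep p (c • u) f (fun i => c • g i) ∧
      ∑' i, ‖f i‖ * ‖c • g i‖ = ‖c‖ * ∑' i, ‖f i‖ * ‖g i‖ := by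
  have hq : ENNReal.ofReal p.conjExponent ≠ 0 := by
    have hpq : p.HolderConjugate p.conjExponent := .conjExponent hp
    simpa using hpq.symm.pos
  have e : (fun i => ‖f i‖ * ‖c • g i‖) = fun i => ‖c‖ * (‖f i‖ * ‖g i‖) := by
    funext i
    rw [lp.norm_const_smul hq]
    ring
  refine ⟨⟨by rw [e]; exact h.1.mul_left _, fun x => ?_⟩, by rw [e, tsum_mul_left]⟩
  have e' : (fun i => conv (c • g i : Ell G p.conjExponent) (check (f i)) x) =
      fun i => c * conv (g i) (check (f i)) x := by
    funext i
    rw [conv_check, conv_check, ← tsum_mul_left]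
    refine tsum_congr fun y => ?_
    rw [lp.coeFn_smul, Pi.smul_apply, smul_eq_mul, mul_assoc]
  rw [e']
  exact (h.2 x).mul_left c

/-- Alternate the terms of two sequences. -/
def interleave {α : Type*} (a b : ℕ → α) (n : ℕ) : α := if Even n then a (n / 2) else b (n / 2)

theorem interleave_even {α : Type*} (a b : ℕ → α) (n : ℕ) : interleave a b (2 * n) = a n := by
  simp [interleave]

theorem interleave_odd {α : Type*} (a b : ℕ → α) (n : ℕ) : interleave a b (2 * n + 1) = b n := by
  have : (2 * n + 1) / 2 = n := by omega
  simp [interleave, this]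

theorem IsHerzRep.add {u v : G → ℂ} {f f' : ℕ → Ell G p}
    {g g' : ℕ → Ell G p.conjExponent} (h : IsHerzRep p u f g) (h' : IsHerzRep p v f' g') :
    IsHerzRep p (u + v) (interleave f f') (interleave g g') ∧
      ∑' i, ‖interleave f f' i‖ * ‖interleave g g' i‖ =
        ∑' i, ‖f i‖ * ‖g i‖ + ∑' i, ‖f' i‖ * ‖g' i‖ := by
  have hs : HasSum (fun i => ‖interleave f f' i‖ * ‖interleave g g' i‖)
      (∑' i, ‖f i‖ * ‖g i‖ + ∑' i, ‖f' i‖ * ‖g' i‖) := by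
    apply HasSum.even_add_odd
    · simpa only [interleave_even] using h.1.hasSum
    · simpa only [interleave_odd] using h'.1.hasSum
  refine ⟨⟨hs.summable, fun x => ?_⟩, hs.tsum_eq⟩
  apply HasSum.even_add_odd
  · simpa only [interleave_even] using h.2 x
  · simpa only [interleave_odd] using h'.2 x

end lemmas

/-- The Herz algebra `A_p(G)`, as a linear space of functions on `G`. -/
def herz (G : Type*) [Group G] (p : ℝ) [Fact (1 < p)] : Submodule ℂ (G → ℂ) where
  carrier := {u | ∃ f g, IsHerzRep p u f g}
  zero_mem' := ⟨0, 0, isHerzRep_zero⟩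
  add_mem' := by
    rintro u v ⟨f, g, h⟩ ⟨f', g', h'⟩
    exact ⟨_, _, (h.add h').1⟩
  smul_mem' := by
    rintro c u ⟨f, g, h⟩
    exact ⟨_, _, (h.smul Fact.out c).1⟩

/-- The numbers `∑ i, ‖f_i‖_p ‖g_i‖_q`, over all representations `u = ∑ i, g_i * f_i^∨`. -/
def herzCosts {G : Type*} [Group G] (p : ℝ) (u : G → ℂ) : Set ℝ :=
  {r | ∃ f g, IsHerzRep p u f g ∧ r = ∑' i, ‖f i‖ * ‖g i‖}

theorem costs_nonneg {G : Type*} [Group G] {p : ℝ} (u : G → ℂ) : ∀ r ∈ herzCosts p u, 0 ≤ r := by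
  rintro r ⟨f, g, -, rfl⟩
  exact tsum_nonneg fun i => mul_nonneg (lp.norm_nonneg' _) (lp.norm_nonneg' _)

theorem costs_bddBelow {G : Type*} [Group G] {p : ℝ} (u : G → ℂ) : BddBelow (herzCosts p u) := ⟨0, costs_nonneg u⟩

/-- `A_p(G)` as a type of its own (so that it carries the `A_p`-norm and not the topology of pointwise
convergence). -/
def HerzAlgebra (G : Type*) [Group G] (p : ℝ) [Fact (1 < p)] : Type _ := herz G p

namespace HerzAlgebra

variable {G : Type*} [Group G] {p : ℝ} [Fact (1 < p)]

instance : AddCommGroup (HerzAlgebra G p) := inferInstanceAs (AddCommGroup (herz G p))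

instance : Module ℂ (HerzAlgebra G p) := inferInstanceAs (Module ℂ (herz G p))

/-- The inclusion of `A_p(G)` into the space of functions on `G`. -/
def toFun : HerzAlgebra G p →ₗ[ℂ] (G → ℂ) := (herz G p).subtype

/-- The element of `A_p(G)` given by a function in it. -/
def mk (u : G → ℂ) (hu : u ∈ herz G p) : HerzAlgebra G p := ⟨u, hu⟩

theorem toFun_mem (v : HerzAlgebra G p) : toFun v ∈ herz G p := v.2

@[simp] theorem toFun_mk (u : G → ℂ) (hu : u ∈ herz G p) : toFun (mk u hu) = u := rfl

theorem toFun_injective : Function.Injective (toFun : HerzAlgebra G p → (G → ℂ)) :=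
  Subtype.val_injective

/-- `‖u‖_{A_p} = inf ∑ i, ‖f_i‖_p ‖g_i‖_q` over all representations `u = ∑ i, g_i * f_i^∨`. -/
instance : Norm (HerzAlgebra G p) := ⟨fun v => sInf (herzCosts p (toFun v))⟩

theorem norm_def (v : HerzAlgebra G p) : ‖v‖ = sInf (herzCosts p (toFun v)) := rfl

theorem costs_nonempty (v : HerzAlgebra G p) : (herzCosts p (toFun v)).Nonempty := by
  obtain ⟨f, g, h⟩ := toFun_mem v
  exact ⟨_, f, g, h, rfl⟩

theorem norm_apply_le (v : HerzAlgebra G p) (x : G) : ‖toFun v x‖ ≤ ‖v‖ := by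
  refine le_csInf (costs_nonempty v) ?_
  rintro r ⟨f, g, h, rfl⟩
  exact h.bound Fact.out x

theorem norm_smul_le_aux (c : ℂ) (v : HerzAlgebra G p) : ‖c • v‖ ≤ ‖c‖ * ‖v‖ := by
  rcases eq_or_ne c 0 with rfl | hc
  · rw [zero_smul, norm_zero, zero_mul, norm_def]
    refine csInf_le (costs_bddBelow _) ⟨0, 0, ?_, by simp⟩
    rw [map_zero]
    exact isHerzRep_zero
  · rw [← div_le_iff₀' (norm_pos_iff.2 hc)]
    refine le_csInf (costs_nonempty v) ?_
    rintro r ⟨f, g, h, rfl⟩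
    rw [div_le_iff₀' (norm_pos_iff.2 hc), ← (h.smul Fact.out c).2]
    refine csInf_le (costs_bddBelow _) ⟨_, _, ?_, rfl⟩
    rw [map_smul]
    exact (h.smul Fact.out c).1

theorem core : NormedSpace.Core ℂ (HerzAlgebra G p) where
  norm_nonneg v := Real.sInf_nonneg (costs_nonneg _)
  norm_smul c v := by
    refine le_antisymm (norm_smul_le_aux c v) ?_
    rcases eq_or_ne c 0 with rfl | hc
    · rw [norm_zero, zero_mul]
      exact Real.sInf_nonneg (costs_nonneg _)
    · have := norm_smul_le_aux c⁻¹ (c • v)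
      rw [inv_smul_smul₀ hc, norm_inv] at this
      rwa [← le_inv_mul_iff₀ (norm_pos_iff.2 hc)]
  norm_triangle v w := by
    refine le_of_forall_pos_lt_add fun ε hε => ?_
    obtain ⟨r, ⟨f, g, h, rfl⟩, hr⟩ :=
      exists_lt_of_csInf_lt (costs_nonempty v) (lt_add_of_pos_right _ (half_pos hε))
    obtain ⟨r', ⟨f', g', h', rfl⟩, hr'⟩ :=
      exists_lt_of_csInf_lt (costs_nonempty w) (lt_add_of_pos_right _ (half_pos hε))
    have : ‖v + w‖ ≤ ∑' i, ‖f i‖ * ‖g i‖ + ∑' i, ‖f' i‖ * ‖g' i‖ := by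
      rw [← (h.add h').2]
      refine csInf_le (costs_bddBelow _) ⟨_, _, ?_, rfl⟩
      rw [map_add]
      exact (h.add h').1
    rw [norm_def v, norm_def w]
    linarith
  norm_eq_zero_iff v := by
    constructor
    · intro h
      apply toFun_injective
      funext x
      have := norm_apply_le v x
      rw [h] at this
      simpa using this
    · rintro rfl
      have h := norm_smul_le_aux (0 : ℂ) (0 : HerzAlgebra G p)
      rw [zero_smul, norm_zero, zero_mul] at h
      exact le_antisymm h (Real.sInf_nonneg (costs_nonneg _))

instance : NormedAddCommGroup (HerzAlgebra G p) := NormedAddCommGroup.ofCore core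

instance : NormedSpace ℂ (HerzAlgebra G p) := NormedSpace.ofCore core

end HerzAlgebra

/-- The multipliers `B_p(G)`: bounded (continuity is automatic) functions `u` with `u v ∈ A_p(G)` for
all `v ∈ A_p(G)`. -/
def multipliers (G : Type*) [Group G] (p : ℝ) [Fact (1 < p)] : Set (G → ℂ) :=
  {u | (∃ C : ℝ, ∀ x, ‖u x‖ ≤ C) ∧ ∀ v ∈ herz G p, u * v ∈ herz G p}

/-- The operator `Γ_u : A_p(G) → A_p(G)`, `v ↦ u v`, for `u ∈ B_p(G)`. -/
def Gam {G : Type*} [Group G] {p : ℝ} [Fact (1 < p)] (u : G → ℂ) (hu : u ∈ multipliers G p) :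
    HerzAlgebra G p →ₗ[ℂ] HerzAlgebra G p where
  toFun v := HerzAlgebra.mk (u * HerzAlgebra.toFun v) (hu.2 _ v.toFun_mem)
  map_add' v w := HerzAlgebra.toFun_injective (by simp [mul_add])
  map_smul' c v := HerzAlgebra.toFun_injective (by simp)

/-- A linear operator is weakly compact if the image of the closed unit ball is relatively compact in
the weak topology. -/
def IsWeaklyCompactOperator {E F : Type*} [NormedAddCommGroup E] [NormedSpace ℂ E]
    [NormedAddCommGroup F] [NormedSpace ℂ F] (T : E →ₗ[ℂ] F) : Prop :=
  IsCompact (closure (toWeakSpace ℂ F '' (T '' Metric.closedBall 0 1)))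

/-- `WCB_p(G)`, the multipliers `u ∈ B_p(G)` with `Γ_u` weakly compact. -/
def WCB (G : Type*) [Group G] (p : ℝ) [Fact (1 < p)] : Set (G → ℂ) :=
  {u | ∃ hu : u ∈ multipliers G p, IsWeaklyCompactOperator (Gam u hu)}

/-- Left translation `x ↦ f(a⁻¹ x)` on real `ℓ^∞(G)`. -/
def translate {G : Type*} [Group G] (a : G) (f : lp (fun _ : G => ℝ) ∞) : lp (fun _ : G => ℝ) ∞ :=
  ⟨fun x => f (a⁻¹ * x), memℓp_infty <| by
    obtain ⟨C, hC⟩ := memℓp_infty_iff.1 (lp.memℓp f)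
    refine ⟨C, ?_⟩
    rintro _ ⟨x, rfl⟩
    exact hC ⟨a⁻¹ * x, rfl⟩⟩

/-- A discrete group is amenable if `ℓ^∞(G)` has a left-invariant mean. -/
def IsAmenable (G : Type*) [Group G] : Prop :=
  ∃ m : lp (fun _ : G => ℝ) ∞ →ₗ[ℝ] ℝ,
    m 1 = 1 ∧ (∀ f : lp (fun _ : G => ℝ) ∞, (∀ x, 0 ≤ f x) → 0 ≤ m f) ∧
      ∀ (a : G) (f : lp (fun _ : G => ℝ) ∞), m (translate a f) = m f

end

end DiscreteHerz

open scoped ENNReal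

namespace DiscreteHerz

noncomputable section

open Filter Topology

variable {G : Type*} [Group G] {p : ℝ}

/-! `A_p(G)` is a Banach algebra. Completeness comes from summing representations; closure under
products comes from expanding `(g * f^∨)(g' * f'^∨)` as the sum over `t` of the coefficients of `y ↦
g(y) g'(y t)` and `y ↦ f(y) f'(y t)`, whose cost Hölder's inequality in `t` controls
(`exists_coeff_mul`).

Compactness: multiplication by a function supported at one point has rank at most one. The elements
acting compactly form a closed subspace; it contains all coefficients of point masses, hence all
coefficients, hence `A_p(G)`.

Converse for amenable `G`: Day's separation argument gives almost invariant probability densities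
`φ`, and the coefficients of `φ^{1/p}`, `φ^{1/q}` lie in the unit ball and tend to `1` pointwise. If
`Γ_u` is weakly compact, their images under `Γ_u` have a weak cluster point in `A_p(G)`. Evaluations
are weakly continuous, so this point is `u`. -/

theorem summable_norm_conv (hp : 1 < p) (f : Ell G p) (g : Ell G p.conjExponent) (x : G) :
    Summable fun y => ‖g y * f (x⁻¹ * y)‖ := by
  have hpq : p.HolderConjugate p.conjExponent := .conjExponent hp
  have hP : (ENNReal.ofReal p).toReal = p := ENNReal.toReal_ofReal hpq.nonneg
  have hQ : (ENNReal.ofReal p.conjExponent).toReal = p.conjExponent :=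
    ENNReal.toReal_ofReal hpq.symm.nonneg
  have hf := lp.hasSum_norm (by rw [hP]; exact hpq.pos) f
  have hg := lp.hasSum_norm (by rw [hQ]; exact hpq.symm.pos) g
  rw [hP] at hf
  rw [hQ] at hg
  have hf' : HasSum (fun y => ‖f (x⁻¹ * y)‖ ^ p) (‖f‖ ^ p) :=
    (Equiv.mulLeft x⁻¹).hasSum_iff.2 hf
  obtain ⟨C, -, -, hsum⟩ := Real.inner_le_Lp_mul_Lq_hasSum_of_nonneg hpq
    (lp.norm_nonneg' f) (lp.norm_nonneg' g) (fun y => norm_nonneg (f (x⁻¹ * y)))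
    (fun y => norm_nonneg (g y)) hf' hg
  exact hsum.summable.congr fun y => by rw [norm_mul, mul_comm]

/-- Representations indexed by an arbitrary type can be reindexed by `ℕ` at the same cost, since
only countably many terms are nonzero. -/
theorem exists_isHerzRep_of_family (hp : 1 < p) {ι : Type*} {u : G → ℂ} (f : ι → Ell G p)
    (g : ι → Ell G p.conjExponent) (hs : Summable fun i => ‖f i‖ * ‖g i‖)
    (hu : ∀ x, HasSum (fun i => conv (g i) (check (f i)) x) (u x)) :
    ∃ f' g', IsHerzRep p u f' g' ∧ ∑' n, ‖f' n‖ * ‖g' n‖ = ∑' i, ‖f i‖ * ‖g i‖ := by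
  have hc := hs.countable_support
  set S := Function.support fun i => ‖f i‖ * ‖g i‖ with hS
  have : Countable S := hc.to_subtype
  obtain ⟨e, he⟩ := exists_injective_nat S
  set f' : ℕ → Ell G p := Function.extend e (fun s => f s) 0 with hf'
  set g' : ℕ → Ell G p.conjExponent := Function.extend e (fun s => g s) 0 with hg'
  have key : ∀ {E : Type _} [AddCommMonoid E] (Φ : Ell G p → Ell G p.conjExponent → E),
      Φ 0 0 = 0 → (fun n => Φ (f' n) (g' n)) =
        Function.extend e (fun s : S => Φ (f s) (g s)) 0 := by
    intro E _ Φ h0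
    funext n
    by_cases hn : ∃ s, e s = n
    · obtain ⟨s, rfl⟩ := hn
      simp [hf', hg', he.extend_apply]
    · simp [hf', hg', Function.extend_apply' _ _ _ hn, h0]
  have h1 : HasSum (fun n => ‖f' n‖ * ‖g' n‖) (∑' i, ‖f i‖ * ‖g i‖) := by
    rw [key (fun a b => ‖a‖ * ‖b‖) (by simp), hasSum_extend_zero he]
    exact (hasSum_subtype_iff_of_support_subset (f := fun i => ‖f i‖ * ‖g i‖) hS.ge).2 hs.hasSum
  refine ⟨f', g', ⟨h1.summable, fun x => ?_⟩, h1.tsum_eq⟩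
  rw [key (fun a b => conv b (check a) x) (by simp [conv]), hasSum_extend_zero he]
  refine (hasSum_subtype_iff_of_support_subset (f := fun i => conv (g i) (check (f i)) x) ?_).2
    (hu x)
  -- A term of zero cost vanishes pointwise by Hölder, so discarding it does not change the sum.
  intro i hi
  by_contra hi'
  have h0 : ‖f i‖ * ‖g i‖ = 0 := Function.notMem_support.1 hi'
  have := conv_bound hp (f i) (g i) x
  rw [h0] at this
  exact hi (norm_le_zero_iff.1 this)

/-! ### Completeness of `A_p(G)` -/

namespace HerzAlgebra

variable [hp : Fact (1 < p)]

theorem exists_of_family {ι : Type*} {u : G → ℂ} (f : ι → Ell G p)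
    (g : ι → Ell G p.conjExponent) (hs : Summable fun i => ‖f i‖ * ‖g i‖)
    (hu : ∀ x, HasSum (fun i => conv (g i) (check (f i)) x) (u x)) :
    ∃ v : HerzAlgebra G p, toFun v = u ∧ ‖v‖ ≤ ∑' i, ‖f i‖ * ‖g i‖ := by
  obtain ⟨f', g', h, h'⟩ := exists_isHerzRep_of_family hp.out f g hs hu
  refine ⟨mk u ⟨f', g', h⟩, rfl, ?_⟩
  rw [← h']
  exact csInf_le (costs_bddBelow _) ⟨f', g', h, rfl⟩

theorem exists_rep_lt (v : HerzAlgebra G p) {ε : ℝ} (hε : 0 < ε) :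
    ∃ f g, IsHerzRep p (toFun v) f g ∧ ∑' i, ‖f i‖ * ‖g i‖ < ‖v‖ + ε := by
  obtain ⟨r, ⟨f, g, h, rfl⟩, hr⟩ :=
    exists_lt_of_csInf_lt (costs_nonempty v) (lt_add_of_pos_right _ hε)
  exact ⟨f, g, h, hr⟩

/-- An absolutely summable series of elements of `A_p(G)` has a pointwise sum in `A_p(G)`. -/
theorem exists_pointwise_sum (w : ℕ → HerzAlgebra G p) (hw : Summable fun n => ‖w n‖) :
    ∃ v : HerzAlgebra G p, (∀ x, HasSum (fun n => toFun (w n) x) (toFun v x)) ∧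
      ‖v‖ ≤ ∑' n, ‖w n‖ := by
  have hsx : ∀ x, Summable fun n => toFun (w n) x := fun x =>
    .of_norm_bounded hw fun n => norm_apply_le (w n) x
  -- Near-optimal representations of the `w n`, with errors of total at most `δ`, combine into one
  -- family over `ℕ × ℕ`. The function obtained does not depend on `δ`, so `δ` can then tend to `0`.
  have main : ∀ δ : ℝ, 0 < δ → ∃ v : HerzAlgebra G p,
      toFun v = (fun x => ∑' n, toFun (w n) x) ∧ ‖v‖ ≤ ∑' n, ‖w n‖ + δ := by
    intro δ hδ
    obtain ⟨ε, hε, c, hc, hcδ⟩ := posSumOfEncodable hδ ℕ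
    choose f g h hlt using fun n => exists_rep_lt (w n) (hε n)
    have hs1 : Summable fun n => ∑' i, ‖f n i‖ * ‖g n i‖ :=
      .of_nonneg_of_le (fun n => tsum_nonneg fun i =>
        mul_nonneg (lp.norm_nonneg' _) (lp.norm_nonneg' _)) (fun n => (hlt n).le)
        (hw.add hc.summable)
    have hs : Summable fun k : ℕ × ℕ => ‖f k.1 k.2‖ * ‖g k.1 k.2‖ :=
      (summable_prod_of_nonneg fun k =>
        mul_nonneg (lp.norm_nonneg' _) (lp.norm_nonneg' _)).2 ⟨fun n => (h n).1, hs1⟩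
    obtain ⟨v, hv, hn⟩ := exists_of_family (u := fun x => ∑' n, toFun (w n) x)
      (fun k : ℕ × ℕ => f k.1 k.2) (fun k => g k.1 k.2) hs fun x => by
        have hsum : Summable fun k : ℕ × ℕ => conv (g k.1 k.2) (check (f k.1 k.2)) x :=
          .of_norm_bounded hs fun k => conv_bound hp.out _ _ x
        have := hsum.hasSum
        have h2 := this.prod_fiberwise fun n => (h n).2 x
        rw [h2.tsum_eq]
        exact this
    refine ⟨v, hv, hn.trans ?_⟩
    rw [hs.tsum_prod' fun n => (h n).1]
    calc _ ≤ ∑' n, (‖w n‖ + ε n) := hs1.tsum_le_tsum (fun n => (hlt n).le) (hw.add hc.summable)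
      _ = ∑' n, ‖w n‖ + c := by rw [hw.tsum_add hc.summable, hc.tsum_eq]
      _ ≤ _ := by linarith
  obtain ⟨v, hv, -⟩ := main 1 one_pos
  refine ⟨v, fun x => ?_, le_of_forall_pos_le_add fun δ hδ => ?_⟩
  · rw [hv]
    exact (hsx x).hasSum
  · obtain ⟨v', hv', hn⟩ := main δ hδ
    rwa [toFun_injective (hv.trans hv'.symm)]

/-- The remainder after `n` terms is the pointwise sum of the tail, so its norm is at most the tail
of `∑ ‖w n‖`. -/
theorem hasSum_of_pointwise (w : ℕ → HerzAlgebra G p) (hw : Summable fun n => ‖w n‖)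
    (v : HerzAlgebra G p) (hv : ∀ x, HasSum (fun n => toFun (w n) x) (toFun v x)) :
    Tendsto (fun n => ∑ i ∈ Finset.range n, w i) atTop (𝓝 v) := by
  rw [tendsto_iff_norm_sub_tendsto_zero]
  refine squeeze_zero (fun _ => norm_nonneg _) (fun n => ?_) (tendsto_sum_nat_add fun n => ‖w n‖)
  obtain ⟨r, hr, hn⟩ := exists_pointwise_sum (fun k => w (k + n))
    ((summable_nat_add_iff n).2 hw)
  have : v - ∑ i ∈ Finset.range n, w i = r := toFun_injective <| by
    funext x
    refine HasSum.unique ?_ (hr x)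
    have := (hasSum_nat_add_iff' n).2 (hv x)
    simpa using this
  rw [norm_sub_rev, this]
  exact hn

instance : CompleteSpace (HerzAlgebra G p) :=
  NormedAddCommGroup.completeSpace_of_summable_imp_tendsto fun w hw => by
    obtain ⟨v, hv, -⟩ := exists_pointwise_sum w hw
    exact ⟨v, hasSum_of_pointwise w hw v hv⟩

/-- Evaluation at a point, as a bounded functional on `A_p(G)`. -/
def evalCLM (x : G) : HerzAlgebra G p →L[ℂ] ℂ :=
  LinearMap.mkContinuous ((LinearMap.proj x).comp toFun) 1 fun v => by
    simpa using norm_apply_le v x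

@[simp] theorem evalCLM_apply (x : G) (v : HerzAlgebra G p) : evalCLM x v = toFun v x := rfl

theorem exists_coeff (f : Ell G p) (g : Ell G p.conjExponent) :
    ∃ v : HerzAlgebra G p, toFun v = conv g (check f) ∧ ‖v‖ ≤ ‖f‖ * ‖g‖ := by
  obtain ⟨v, hv, hn⟩ := exists_of_family (u := conv g (check f)) (fun _ : Unit => f)
    (fun _ => g) (hasSum_unique _).summable fun x => hasSum_unique _
  exact ⟨v, hv, by simpa using hn⟩

/-- The coefficient function `g * f^∨`, as an element of `A_p(G)`. -/
def coeff (f : Ell G p) (g : Ell G p.conjExponent) : HerzAlgebra G p := (exists_coeff f g).choose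

@[simp] theorem toFun_coeff (f : Ell G p) (g : Ell G p.conjExponent) :
    toFun (coeff f g) = conv g (check f) := (exists_coeff f g).choose_spec.1

theorem norm_coeff_le (f : Ell G p) (g : Ell G p.conjExponent) : ‖coeff f g‖ ≤ ‖f‖ * ‖g‖ :=
  (exists_coeff f g).choose_spec.2

/-- Upgrades pointwise convergence of a representation to norm convergence, so that closed subspaces
and bounded maps can be used. -/
theorem _root_.DiscreteHerz.IsHerzRep.hasSum_coeff {v : HerzAlgebra G p} {f : ℕ → Ell G p}
    {g : ℕ → Ell G p.conjExponent} (h : IsHerzRep p (toFun v) f g) :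
    HasSum (fun i => coeff (f i) (g i)) v := by
  have hs : Summable fun i => ‖coeff (f i) (g i)‖ :=
    .of_nonneg_of_le (fun _ => norm_nonneg _) (fun i => norm_coeff_le _ _) h.1
  have := hasSum_of_pointwise _ hs v (by simpa using h.2)
  rw [← tendsto_nhds_unique hs.of_norm.hasSum.tendsto_sum_nat this]
  exact hs.of_norm.hasSum

end HerzAlgebra

/-! ### Products in `A_p(G)` -/

/-- The equivalence `(t, y) ↦ (y, y t)`. -/
def shear (G : Type*) [Group G] : G × G ≃ G × G where
  toFun k := (k.2, k.2 * k.1)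
  invFun k := (k.1⁻¹ * k.2, k.1)
  left_inv k := by simp
  right_inv k := by simp

theorem hasSum_norm_rpow {X : Type*} {r : ℝ} (hr : 0 < r) (F : Ell X r) :
    HasSum (fun y => ‖F y‖ ^ r) (‖F‖ ^ r) := by
  have hR : (ENNReal.ofReal r).toReal = r := ENNReal.toReal_ofReal hr.le
  simpa only [hR] using lp.hasSum_norm (by rwa [hR]) F

theorem hasSum_shear_rpow {r : ℝ} (hr : 0 < r) (F F' : Ell G r) :
    HasSum (fun k : G × G => ‖F k.2 * F' (k.2 * k.1)‖ ^ r) (‖F‖ ^ r * ‖F'‖ ^ r) := by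
  have h1 := hasSum_norm_rpow hr F
  have h2 := hasSum_norm_rpow hr F'
  have h3 := h1.mul h2 (h1.summable.mul_of_nonneg h2.summable
    (fun _ => by dsimp; positivity) (fun _ => by dsimp; positivity))
  refine ((shear G).hasSum_iff.2 h3).congr_fun ?_
  intro k
  simp [shear, Real.mul_rpow]

theorem memℓp_mul_shift {r : ℝ} (hr : 0 < r) (F F' : Ell G r) (t : G) :
    Memℓp (fun y => F y * F' (y * t)) (ENNReal.ofReal r) := by
  refine memℓp_gen ?_
  rw [ENNReal.toReal_ofReal hr.le]
  exact (hasSum_shear_rpow hr F F').summable.prod_factor t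

/-- The function `y ↦ F(y) F'(y t)` in `ℓ^r(G)`. -/
def mulShift {r : ℝ} (hr : 0 < r) (F F' : Ell G r) (t : G) : Ell G r :=
  ⟨fun y => F y * F' (y * t), memℓp_mul_shift hr F F' t⟩

theorem mulShift_apply {r : ℝ} (hr : 0 < r) (F F' : Ell G r) (t y : G) :
    mulShift hr F F' t y = F y * F' (y * t) := rfl

theorem hasSum_norm_mulShift {r : ℝ} (hr : 0 < r) (F F' : Ell G r) :
    HasSum (fun t => ‖mulShift hr F F' t‖ ^ r) ((‖F‖ * ‖F'‖) ^ r) := by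
  rw [Real.mul_rpow (lp.norm_nonneg' _) (lp.norm_nonneg' _)]
  exact (hasSum_shear_rpow hr F F').prod_fiberwise fun t => hasSum_norm_rpow hr (mulShift hr F F' t)

theorem hasSum_tsum_mul_shift {a b : G → ℂ} (ha : Summable fun y => ‖a y‖)
    (hb : Summable fun y => ‖b y‖) :
    HasSum (fun t => ∑' y, a y * b (y * t)) ((∑' y, a y) * ∑' y, b y) := by
  have h := ha.of_norm.hasSum.mul hb.of_norm.hasSum (summable_mul_of_summable_norm ha hb)
  have h' : HasSum (fun k : G × G => a k.2 * b (k.2 * k.1)) ((∑' y, a y) * ∑' y, b y) :=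
    ((shear G).hasSum_iff.2 h).congr_fun fun _ => rfl
  exact h'.prod_fiberwise fun t => (h'.summable.prod_factor t).hasSum

/-- The product of the two sums is a double sum over `(y, z)`; substituting `z = y t` and summing
over `y` first leaves a coefficient function for each `t`. -/
theorem hasSum_conv_mulShift (hp : 1 < p) (hp0 : 0 < p)
    (hq : 0 < p.conjExponent) (f f' : Ell G p) (g g' : Ell G p.conjExponent) (x : G) :
    HasSum (fun t => conv (mulShift hq g g' t) (check (mulShift hp0 f f' t)) x)
      (conv g (check f) x * conv g' (check f') x) := by
  rw [conv_check, conv_check]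
  refine (hasSum_tsum_mul_shift (summable_norm_conv hp f g x)
    (summable_norm_conv hp f' g' x)).congr_fun fun t => ?_
  rw [conv_check]
  refine tsum_congr fun y => ?_
  rw [mulShift_apply, mulShift_apply, mul_assoc x⁻¹]
  ring

namespace HerzAlgebra

variable [hp : Fact (1 < p)]

/-- Hölder in `t`: the `p`-th and `q`-th powers of the norms of the shifted products sum to `(‖f‖
‖f'‖)^p` and `(‖g‖ ‖g'‖)^q`. The family is indexed by `G`, possibly uncountable. -/
theorem exists_coeff_mul (f f' : Ell G p) (g g' : Ell G p.conjExponent) :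
    ∃ v : HerzAlgebra G p, toFun v = toFun (coeff f g) * toFun (coeff f' g') ∧
      ‖v‖ ≤ (‖f‖ * ‖g‖) * (‖f'‖ * ‖g'‖) := by
  have hpq : p.HolderConjugate p.conjExponent := .conjExponent hp.out
  have hF := hasSum_norm_mulShift hpq.pos f f'
  have hG := hasSum_norm_mulShift hpq.symm.pos g g'
  obtain ⟨C, -, hC, hsum⟩ := Real.inner_le_Lp_mul_Lq_hasSum_of_nonneg hpq
    (mul_nonneg (lp.norm_nonneg' _) (lp.norm_nonneg' _))
    (mul_nonneg (lp.norm_nonneg' _) (lp.norm_nonneg' _))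
    (fun t => lp.norm_nonneg' _) (fun t => lp.norm_nonneg' _) hF hG
  obtain ⟨v, hv, hn⟩ := exists_of_family (u := toFun (coeff f g) * toFun (coeff f' g'))
    _ _ hsum.summable fun x => by
      simpa using hasSum_conv_mulShift hp.out hpq.pos hpq.symm.pos f f' g g' x
  refine ⟨v, hv, hn.trans ?_⟩
  rw [hsum.tsum_eq]
  linarith

/-- `A_p(G)` is closed under products, and its norm is submultiplicative. -/
theorem exists_mul (u v : HerzAlgebra G p) :
    ∃ w : HerzAlgebra G p, toFun w = toFun u * toFun v ∧ ‖w‖ ≤ ‖u‖ * ‖v‖ := by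
  have main : ∀ ε : ℝ, 0 < ε → ∃ w : HerzAlgebra G p, toFun w = toFun u * toFun v ∧
      ‖w‖ ≤ (‖u‖ + ε) * (‖v‖ + ε) := by
    intro ε hε
    obtain ⟨f, g, h, hlt⟩ := exists_rep_lt u hε
    obtain ⟨f', g', h', hlt'⟩ := exists_rep_lt v hε
    choose w hw hwn using fun k : ℕ × ℕ => exists_coeff_mul (f k.1) (f' k.2) (g k.1) (g' k.2)
    have hs := h.1.mul_of_nonneg h'.1
      (fun _ => mul_nonneg (lp.norm_nonneg' _) (lp.norm_nonneg' _))
      (fun _ => mul_nonneg (lp.norm_nonneg' _) (lp.norm_nonneg' _))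
    have hsw : Summable fun k => ‖w k‖ := .of_nonneg_of_le (fun _ => norm_nonneg _) hwn hs
    refine ⟨∑' k, w k, ?_, ?_⟩
    · funext x
      have e1 := hsw.of_norm.hasSum.mapL (evalCLM x)
      have a1 := h.hasSum_coeff.mapL (evalCLM x)
      have a2 := h'.hasSum_coeff.mapL (evalCLM x)
      have e2 := a1.mul a2 (e1.summable.congr fun k => by simp [hw])
      refine HasSum.unique (e1.congr_fun fun k => ?_) e2
      simp [hw]
    · refine (norm_tsum_le_tsum_norm hsw).trans ((hsw.tsum_le_tsum hwn hs).trans ?_)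
      rw [← h.1.tsum_mul_tsum h'.1 hs]
      have : 0 ≤ ∑' i, ‖f' i‖ * ‖g' i‖ :=
        tsum_nonneg fun _ => mul_nonneg (lp.norm_nonneg' _) (lp.norm_nonneg' _)
      gcongr
  obtain ⟨w, hw, -⟩ := main 1 one_pos
  refine ⟨w, hw, ?_⟩
  have hlim : Tendsto (fun ε : ℝ => (‖u‖ + ε) * (‖v‖ + ε)) (𝓝[>] 0) (𝓝 (‖u‖ * ‖v‖)) := by
    have : Continuous fun ε : ℝ => (‖u‖ + ε) * (‖v‖ + ε) := by fun_prop
    simpa using (this.tendsto 0).mono_left nhdsWithin_le_nhds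
  refine ge_of_tendsto hlim (eventually_mem_nhdsWithin.mono fun ε hε => ?_)
  obtain ⟨w', hw', hn⟩ := main ε hε
  rwa [toFun_injective (hw.trans hw'.symm)]

theorem mul_mem {u v : G → ℂ} (hu : u ∈ herz G p) (hv : v ∈ herz G p) : u * v ∈ herz G p := by
  obtain ⟨w, hw, -⟩ := exists_mul (mk u hu) (mk v hv)
  rw [← toFun_mk u hu, ← toFun_mk v hv, ← hw]
  exact toFun_mem w

theorem mem_multipliers {u : G → ℂ} (hu : u ∈ herz G p) : u ∈ multipliers G p :=
  ⟨⟨‖mk u hu‖, norm_apply_le (mk u hu)⟩, fun _ hv => mul_mem hu hv⟩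

/-- Multiplication on `A_p(G)`, as a bounded bilinear map. -/
def mulCLM : HerzAlgebra G p →L[ℂ] HerzAlgebra G p →L[ℂ] HerzAlgebra G p :=
  LinearMap.mkContinuous₂
    (LinearMap.mk₂ ℂ
      (fun u v => mk (toFun u * toFun v) (mul_mem (toFun_mem u) (toFun_mem v)))
      (fun _ _ _ => toFun_injective (by simp [add_mul]))
      (fun _ _ _ => toFun_injective (by simp))
      (fun _ _ _ => toFun_injective (by simp [mul_add]))
      (fun _ _ _ => toFun_injective (by simp))) 1 fun u v => by
    obtain ⟨w, hw, hn⟩ := exists_mul u v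
    have e : mk (toFun u * toFun v) (mul_mem (toFun_mem u) (toFun_mem v)) = w :=
      toFun_injective hw.symm
    simpa [e] using hn

@[simp] theorem toFun_mulCLM (u v : HerzAlgebra G p) :
    toFun (mulCLM u v) = toFun u * toFun v := rfl

end HerzAlgebra

/-! ### Compactness of multiplication by elements of `A_p(G)` -/

namespace HerzAlgebra

variable [hp : Fact (1 < p)]

instance fact_one_le_ofReal : Fact (1 ≤ ENNReal.ofReal p) :=
  ⟨by simpa using hp.out.le⟩

instance fact_one_le_ofReal_conjExponent : Fact (1 ≤ ENNReal.ofReal p.conjExponent) :=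
  ⟨by simpa using (Real.HolderConjugate.conjExponent hp.out).symm.lt.le⟩

/-- `(f, g) ↦ g * f^∨` as a bounded bilinear map. -/
def coeffCLM : Ell G p →L[ℂ] Ell G p.conjExponent →L[ℂ] HerzAlgebra G p :=
  LinearMap.mkContinuous₂
    (LinearMap.mk₂ ℂ coeff
      (fun f f' g => toFun_injective <| by
        funext x
        have h := (summable_norm_conv hp.out f g x).of_norm
        have h' := (summable_norm_conv hp.out f' g x).of_norm
        simp only [toFun_coeff, map_add, Pi.add_apply, conv_check]
        rw [← h.tsum_add h']
        exact tsum_congr fun y => mul_add _ _ _)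
      (fun c f g => toFun_injective <| by
        funext x
        simp only [toFun_coeff, map_smul, Pi.smul_apply, conv_check, smul_eq_mul]
        rw [← tsum_mul_left]
        exact tsum_congr fun y => mul_left_comm _ _ _)
      (fun f g g' => toFun_injective <| by
        funext x
        have h := (summable_norm_conv hp.out f g x).of_norm
        have h' := (summable_norm_conv hp.out f g' x).of_norm
        simp only [toFun_coeff, map_add, Pi.add_apply, conv_check]
        rw [← h.tsum_add h']
        exact tsum_congr fun y => add_mul _ _ _)
      (fun c f g => toFun_injective <| by
        funext x
        simp only [toFun_coeff, map_smul, Pi.smul_apply, conv_check, smul_eq_mul]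
        rw [← tsum_mul_left]
        exact tsum_congr fun y => mul_assoc _ _ _)) 1 fun f g => by
    simpa using norm_coeff_le f g

/-- Here `w v = v(x) w`, so the operator factors through evaluation at `x` into `ℂ`. -/
theorem isCompactOperator_mulCLM_of_support {w : HerzAlgebra G p} {x : G}
    (hw : ∀ y, y ≠ x → toFun w y = 0) : IsCompactOperator (mulCLM w) := by
  have h : (mulCLM w : HerzAlgebra G p → HerzAlgebra G p) =
      (ContinuousLinearMap.toSpanSingleton ℂ w) ∘ evalCLM x := by
    funext v
    apply toFun_injective
    funext y
    rcases eq_or_ne y x with rfl | hy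
    · simp [mul_comm]
    · simp [hw y hy]
  rw [h]
  exact (isCompactOperator_of_locallyCompactSpace_dom (evalCLM x)).clm_comp
    (ContinuousLinearMap.toSpanSingleton ℂ w)

/-- The elements of `A_p(G)` that act compactly on `A_p(G)` by multiplication. -/
def compactMultipliers (G : Type*) [Group G] (p : ℝ) [Fact (1 < p)] :
    Submodule ℂ (HerzAlgebra G p) :=
  (compactOperator (RingHom.id ℂ) (HerzAlgebra G p) (HerzAlgebra G p)).comap
    (mulCLM : HerzAlgebra G p →L[ℂ] _).toLinearMap

theorem mem_compactMultipliers {u : HerzAlgebra G p} :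
    u ∈ compactMultipliers G p ↔ IsCompactOperator (mulCLM u) := Iff.rfl

theorem isClosed_compactMultipliers : IsClosed (compactMultipliers G p : Set (HerzAlgebra G p)) :=
  (isClosed_setOfPred_isCompactOperator (σ₁₂ := RingHom.id ℂ)).preimage
    (mulCLM : HerzAlgebra G p →L[ℂ] _).continuous

theorem _root_.HasSum.mem_of_isClosed_submodule {E ι : Type*} [NormedAddCommGroup E]
    [NormedSpace ℂ E] {K : Submodule ℂ E} (hK : IsClosed (K : Set E)) {w : ι → E} {v : E}
    (h : HasSum w v) (hw : ∀ i, w i ∈ K) : v ∈ K :=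
  hK.mem_of_tendsto h (.of_forall fun _ => K.sum_mem fun i _ => hw i)

open Classical in
-- The coefficient of point masses at `b` and `a` is supported at `a b⁻¹`.
theorem coeff_single_single_mem (a b : G) (c d : ℂ) :
    coeff (lp.single (ENNReal.ofReal p) b c) (lp.single (ENNReal.ofReal p.conjExponent) a d) ∈
      compactMultipliers G p := by
  refine mem_compactMultipliers.2 <|
    isCompactOperator_mulCLM_of_support (x := a * b⁻¹) fun z hz => ?_
  rw [toFun_coeff, conv_check]
  refine (tsum_congr fun y => ?_).trans tsum_zero
  rcases eq_or_ne y a with rfl | hy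
  · have h : z⁻¹ * y ≠ b := by
      rintro rfl
      simp at hz
    exact mul_eq_zero_of_right _ (lp.single_apply_ne (E := fun _ : G => ℂ) _ b c h)
  · exact mul_eq_zero_of_left (lp.single_apply_ne (E := fun _ : G => ℂ) _ a d hy) _

/-- Both exponents are finite, so `f` and `g` are norm sums of point masses; boundedness of
`coeffCLM` allows expanding one variable at a time. -/
theorem coeff_mem_compactMultipliers (f : Ell G p) (g : Ell G p.conjExponent) :
    coeff f g ∈ compactMultipliers G p := by
  classical
  have hf := lp.hasSum_single ENNReal.ofReal_ne_top f
  have hg := lp.hasSum_single ENNReal.ofReal_ne_top g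
  refine (hf.mapL (coeffCLM.flip g)).mem_of_isClosed_submodule isClosed_compactMultipliers
    fun b => ?_
  exact (hg.mapL (coeffCLM _)).mem_of_isClosed_submodule isClosed_compactMultipliers
    fun a => coeff_single_single_mem _ _ _ _

theorem isCompactOperator_mulCLM (u : HerzAlgebra G p) : IsCompactOperator (mulCLM u) := by
  obtain ⟨f, g, h⟩ := toFun_mem u
  exact mem_compactMultipliers.1 <| (IsHerzRep.hasSum_coeff h).mem_of_isClosed_submodule
    isClosed_compactMultipliers fun i => coeff_mem_compactMultipliers _ _

end HerzAlgebra

/-! ### Weakly compact multipliers -/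

open HerzAlgebra

theorem isCompactOperator_Gam [Fact (1 < p)] {u : G → ℂ} (hu : u ∈ herz G p)
    (hu' : u ∈ multipliers G p) : IsCompactOperator (Gam u hu') :=
  isCompactOperator_mulCLM (mk u hu)

theorem _root_.IsCompactOperator.isWeaklyCompactOperator {E F : Type*} [NormedAddCommGroup E]
    [NormedSpace ℂ E] [NormedAddCommGroup F] [NormedSpace ℂ F] {T : E →ₗ[ℂ] F}
    (hT : IsCompactOperator T) : IsWeaklyCompactOperator T := by
  obtain ⟨K, hK, hsub⟩ := hT.image_closedBall_subset_compact (f := T) 1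
  have hK' : IsCompact (toWeakSpace ℂ F '' K) := hK.image (toWeakSpaceCLM ℂ F).continuous
  exact hK'.of_isClosed_subset isClosed_closure
    (closure_minimal (Set.image_mono hsub) hK'.isClosed)

/-- If the constant function `1` is a pointwise limit of elements of the unit ball of `A_p(G)`, then
every weakly compact multiplier is in `A_p(G)`. -/
theorem mem_herz_of_mem_WCB [Fact (1 < p)]
    (H : ∀ (F : Finset G) (ε : ℝ), 0 < ε → ∃ e : HerzAlgebra G p, ‖e‖ ≤ 1 ∧
      ∀ x ∈ F, ‖toFun e x - 1‖ < ε) {u : G → ℂ} (hu : u ∈ WCB G p) : u ∈ herz G p := by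
  classical
  obtain ⟨hm, hc⟩ := hu
  choose e he hlt using fun k : Finset G × {ε : ℝ // 0 < ε} => H k.1 k.2 k.2.2
  have h1 : ∀ n : Finset G × ℕ, (0 : ℝ) < 1 / (n.2 + 1) := fun n => Nat.one_div_pos_of_nat
  set w : Finset G × ℕ → WeakSpace ℂ (HerzAlgebra G p) := fun n =>
    toWeakSpace ℂ _ (Gam u hm (e (n.1, ⟨1 / (n.2 + 1), h1 n⟩)))
  have hlim : ∀ x, Tendsto (fun n : Finset G × ℕ => toFun (e (n.1, ⟨1 / (n.2 + 1), h1 n⟩)) x)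
      atTop (𝓝 1) := by
    intro x
    rw [Metric.tendsto_atTop]
    intro ε hε
    obtain ⟨N, hN⟩ := exists_nat_one_div_lt hε
    refine ⟨({x}, N), fun n hn => ?_⟩
    rw [dist_eq_norm]
    refine (hlt (n.1, ⟨1 / (n.2 + 1), h1 n⟩) x (hn.1 (by simp))).trans_le (le_trans ?_ hN.le)
    exact Nat.one_div_le_one_div hn.2
  obtain ⟨v, -, hv⟩ := hc.exists_mapClusterPt (f := atTop) (u := w) (by
    refine le_principal_iff.2 (mem_map.2 (Eventually.of_forall fun n => subset_closure ?_))
    exact ⟨_, ⟨_, by simpa using he _, rfl⟩, rfl⟩)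
  -- Evaluation at `x` is weakly continuous, so `v(x)` is a cluster value of a net `u(x) e(x)` that
  -- converges to `u(x)`.
  have hu : u = toFun ((toWeakSpace ℂ _).symm v) := by
    funext x
    have hcont : Continuous fun v : WeakSpace ℂ (HerzAlgebra G p) =>
        evalCLM x ((toWeakSpace ℂ _).symm v) :=
      WeakBilin.eval_continuous _ (evalCLM x)
    have h2 := hv.continuousAt_comp hcont.continuousAt
    have h3 : Tendsto ((fun v : WeakSpace ℂ (HerzAlgebra G p) =>
        evalCLM x ((toWeakSpace ℂ _).symm v)) ∘ w) atTop (𝓝 (u x)) := by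
      rw [← mul_one (u x)]
      exact ((hlim x).const_mul (u x)).congr fun n => rfl
    exact (eq_of_nhds_neBot (ClusterPt.mono h2 h3)).symm
  rw [hu]
  exact toFun_mem _

/-! ### Almost invariant densities from an invariant mean -/

/-- Tuples `(λ_a φ - φ)_{a ∈ F}` in `ℓ^1(G)`, over probability densities `φ` on `G`. -/
def translationDefects (F : Finset G) : Set (F → lp (fun _ : G => ℝ) 1) :=
  {v | ∃ φ : G → ℝ, (∀ y, 0 ≤ φ y) ∧ HasSum φ 1 ∧ ∀ a y, v a y = φ ((a : G)⁻¹ * y) - φ y}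

theorem convex_translationDefects (F : Finset G) : Convex ℝ (translationDefects F) := by
  rintro v ⟨φ, h0, h1, hv⟩ w ⟨ψ, h0', h1', hw⟩ s t hs ht hst
  refine ⟨fun y => s * φ y + t * ψ y, fun y => ?_, ?_, fun a y => ?_⟩
  · have := h0 y
    have := h0' y
    positivity
  · simpa [hst] using (h1.mul_left s).add (h1'.mul_left t)
  · simp only [Pi.add_apply, Pi.smul_apply, lp.coeFn_add, lp.coeFn_smul, hv, hw, smul_eq_mul]
    ring

open Classical in
theorem single_sub_single_mem (F : Finset G) (y : G) :
    (fun a : F => (lp.single 1 ((a : G) * y) 1 - lp.single 1 y 1 : lp (fun _ : G => ℝ) 1)) ∈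
      translationDefects F := by
  refine ⟨(Pi.single y 1 : G → ℝ), fun z => ?_, ?_, fun a z => ?_⟩
  · by_cases h : z = y
    · subst h; simp
    · simp [h]
  · convert hasSum_ite_eq y (1 : ℝ) using 2 with z
    exact Pi.single_apply y 1 z
  · change (Pi.single ((a : G) * y) 1 : G → ℝ) z - (Pi.single y 1 : G → ℝ) z = _
    congr 1
    simp only [Pi.single_apply, inv_mul_eq_iff_eq_mul]

/-- Reiter's condition, in the form obtained from an invariant mean by Day's convexity argument. -/
theorem IsAmenable.zero_mem_closure (h : IsAmenable G) (F : Finset G) :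
    0 ∈ closure (translationDefects F) := by
  classical
  obtain ⟨m, m1, mpos, minv⟩ := h
  by_contra h0
  -- A functional `ψ` exceeds some `c > 0` on all defects. Its components are the bounded functions
  -- `k a`, and `S y` is `ψ` at the defect of the point mass at `y`. Thus `S ≥ c` pointwise, whereas
  -- invariance gives `m S = 0`.
  obtain ⟨ψ, c, hc, hψ⟩ := geometric_hahn_banach_point_closed
    (convex_translationDefects F).closure isClosed_closure h0
  rw [map_zero] at hc
  set k : F → G → ℝ := fun a y => ψ (Pi.single a (lp.single 1 y 1))
  have hkb : ∀ a, Memℓp (k a) ∞ := by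
    refine fun a => memℓp_infty ⟨‖ψ‖, ?_⟩
    rintro _ ⟨y, rfl⟩
    refine (ψ.le_opNorm _).trans ?_
    rw [Pi.norm_single, lp.norm_single one_pos, norm_one, mul_one]
  set K : F → lp (fun _ : G => ℝ) ∞ := fun a => ⟨k a, hkb a⟩
  set S : lp (fun _ : G => ℝ) ∞ := ∑ a : F, (translate (a : G)⁻¹ (K a) - K a) with hS
  have hSm : m S = 0 := by simp [hS, minv]
  have hψs : ∀ v, ψ v = ∑ a, ψ (Pi.single a (v a)) := fun v => by
    rw [← map_sum, Finset.univ_sum_single]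
  have hSy : ∀ y, c ≤ S y := by
    intro y
    refine (hψ _ (subset_closure (single_sub_single_mem F y))).le.trans_eq ?_
    have e : S y = ∑ a : F, (k a ((a : G)⁻¹⁻¹ * y) - k a y) := by
      rw [hS, lp.coeFn_sum, Finset.sum_apply]
      rfl
    rw [hψs, e]
    refine Finset.sum_congr rfl fun a _ => ?_
    rw [Pi.single_sub, map_sub, inv_inv]
  have h2 := mpos (S - c • 1) fun y => by
    have e : (S - c • 1 : lp (fun _ : G => ℝ) ∞) y = S y - c * 1 := rfl
    rw [e, mul_one]
    exact sub_nonneg.2 (hSy y)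
  rw [map_sub, map_smul, hSm, m1] at h2
  simp at h2
  linarith

theorem IsAmenable.exists_density (h : IsAmenable G) (F : Finset G) {ε : ℝ} (hε : 0 < ε) :
    ∃ φ : G → ℝ, (∀ y, 0 ≤ φ y) ∧ HasSum φ 1 ∧
      ∀ a ∈ F, ∃ δ < ε, HasSum (fun y => |φ (a⁻¹ * y) - φ y|) δ := by
  obtain ⟨v, ⟨φ, h0, h1, hv⟩, hlt⟩ := Metric.mem_closure_iff.1 (h.zero_mem_closure F) ε hε
  rw [dist_zero_left] at hlt
  refine ⟨φ, h0, h1, fun a ha => ⟨‖v ⟨a, ha⟩‖, (norm_le_pi_norm v _).trans_lt hlt, ?_⟩⟩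
  have := lp.hasSum_norm (by simp) (v ⟨a, ha⟩)
  simpa [hv] using this

/-! ### Approximating the constant `1` -/

/-- The root `φ^{1/r}` of a probability density, as a unit vector of `ℓ^r(G)`. -/
theorem exists_root {X : Type*} {r : ℝ} (hr : 0 < r) {φ : X → ℝ} (h0 : ∀ y, 0 ≤ φ y)
    (h1 : HasSum φ 1) : ∃ f : Ell X r, ‖f‖ = 1 ∧ ∀ y, f y = ((φ y ^ r⁻¹ : ℝ) : ℂ) := by
  have hR : (ENNReal.ofReal r).toReal = r := ENNReal.toReal_ofReal hr.le
  have e : ∀ y, ‖((φ y ^ r⁻¹ : ℝ) : ℂ)‖ ^ r = φ y := fun y => by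
    rw [Complex.norm_real, Real.norm_of_nonneg (Real.rpow_nonneg (h0 y) _),
      Real.rpow_inv_rpow (h0 y) hr.ne']
  have hmem : Memℓp (fun y => ((φ y ^ r⁻¹ : ℝ) : ℂ)) (ENNReal.ofReal r) :=
    memℓp_gen (by simpa only [hR, e] using h1.summable)
  refine ⟨⟨_, hmem⟩, ?_, fun y => rfl⟩
  have h2 := hasSum_norm_rpow hr (⟨_, hmem⟩ : Ell X r)
  have h3 : HasSum φ (‖(⟨_, hmem⟩ : Ell X r)‖ ^ r) := h2.congr_fun fun y => (e y).symm
  have h4 := h3.unique h1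
  rwa [← Real.one_rpow r, Real.rpow_left_inj (lp.norm_nonneg' _) zero_le_one hr.ne'] at h4

/-- Since the reciprocal exponents add to `1`, `min a b` is the product of its own two powers. This
turns `ℓ^1`-closeness of `φ` and its translate into a lower bound for the coefficient. -/
theorem min_le_rpow_mul_rpow (hp : 1 < p) {a b : ℝ} (ha : 0 ≤ a) (hb : 0 ≤ b) :
    min a b ≤ a ^ p.conjExponent⁻¹ * b ^ p⁻¹ := by
  have hpq : p.HolderConjugate p.conjExponent := .conjExponent hp
  have h0 : 0 ≤ min a b := le_min ha hb
  calc min a b = min a b ^ p.conjExponent⁻¹ * min a b ^ p⁻¹ := by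
        rw [← Real.rpow_add_of_nonneg h0 (inv_nonneg.2 hpq.symm.nonneg) (inv_nonneg.2 hpq.nonneg),
          add_comm, hpq.inv_add_inv_eq_one, Real.rpow_one]
    _ ≤ _ := by
        have := hpq.pos
        have := hpq.symm.pos
        gcongr
        · exact min_le_left _ _
        · exact min_le_right _ _

/-- For amenable `G`, the constant `1` is a pointwise limit of elements of the unit ball of
`A_p(G)`. -/
theorem IsAmenable.exists_approx_one [hp : Fact (1 < p)] (h : IsAmenable G) (F : Finset G) {ε : ℝ}
    (hε : 0 < ε) : ∃ e : HerzAlgebra G p, ‖e‖ ≤ 1 ∧ ∀ x ∈ F, ‖toFun e x - 1‖ < ε := by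
  have hpq : p.HolderConjugate p.conjExponent := .conjExponent hp.out
  obtain ⟨φ, h0, h1, hφ⟩ := h.exists_density F hε
  obtain ⟨f, hf, hfy⟩ := exists_root hpq.pos h0 h1
  obtain ⟨g, hg, hgy⟩ := exists_root hpq.symm.pos h0 h1
  have hn : ‖coeff f g‖ ≤ 1 := by simpa [hf, hg] using norm_coeff_le f g
  refine ⟨coeff f g, hn, fun x hx => ?_⟩
  obtain ⟨δ, hδ, hs⟩ := hφ x hx
  set r : ℝ := ∑' y, φ y ^ p.conjExponent⁻¹ * φ (x⁻¹ * y) ^ p⁻¹ with hr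
  have e : toFun (coeff f g) x = (r : ℂ) := by
    rw [toFun_coeff, conv_check, hr, Complex.ofReal_tsum]
    exact tsum_congr fun y => by rw [hfy, hgy, Complex.ofReal_mul]
  have hsum : Summable fun y => φ y ^ p.conjExponent⁻¹ * φ (x⁻¹ * y) ^ p⁻¹ := by
    refine (summable_norm_conv hp.out f g x).congr fun y => ?_
    rw [hfy, hgy, ← Complex.ofReal_mul, Complex.norm_real, Real.norm_of_nonneg]
    exact mul_nonneg (Real.rpow_nonneg (h0 _) _) (Real.rpow_nonneg (h0 _) _)
  have hle : r ≤ 1 := by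
    have := (norm_apply_le (coeff f g) x).trans hn
    rw [e, Complex.norm_real] at this
    exact (le_abs_self r).trans this
  -- Sum `φ y - |φ (x⁻¹ * y) - φ y| ≤ min (φ y) (φ (x⁻¹ * y))` over `y`.
  have hge : 1 - δ ≤ r := by
    refine hasSum_le (fun y => ?_) (h1.sub hs) hsum.hasSum
    refine le_trans ?_ (min_le_rpow_mul_rpow hp.out (h0 y) (h0 (x⁻¹ * y)))
    refine le_min (by linarith [abs_nonneg (φ (x⁻¹ * y) - φ y)]) ?_
    linarith [neg_abs_le (φ (x⁻¹ * y) - φ y)]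
  rw [e, ← Complex.ofReal_one, ← Complex.ofReal_sub, Complex.norm_real, Real.norm_eq_abs, abs_lt]
  constructor <;> linarith

end

end DiscreteHerz

theorem theorem4p2 (G : Type*) [Group G] (p : ℝ) [Fact (1 < p)] :
    (DiscreteHerz.herz G p : Set (G → ℂ)) ⊆ DiscreteHerz.WCB G p ∧
    (∀ u ∈ DiscreteHerz.herz G p, ∃ hu : u ∈ DiscreteHerz.multipliers G p,
      IsCompactOperator (DiscreteHerz.Gam u hu)) ∧
    (DiscreteHerz.IsAmenable G →
      DiscreteHerz.WCB G p = (DiscreteHerz.herz G p : Set (G → ℂ))) := by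
  have hc : ∀ u (h : u ∈ DiscreteHerz.herz G p), 
      IsCompactOperator (DiscreteHerz.Gam u (DiscreteHerz.HerzAlgebra.mem_multipliers h)) :=
    fun u h => DiscreteHerz.isCompactOperator_Gam h _
  have hsub : (DiscreteHerz.herz G p : Set (G → ℂ)) ⊆ DiscreteHerz.WCB G p :=
    fun u h => ⟨_, (hc u h).isWeaklyCompactOperator⟩
  exact ⟨hsub, fun u h => ⟨_, hc u h⟩, fun hG =>
    Set.Subset.antisymm
      (fun u hu => DiscreteHerz.mem_herz_of_mem_WCB (fun F _ => hG.exists_approx_one F) hu) hsub⟩
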